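/- Consider a function-free first-order language without equality, with a finite set $\mathcal R$ of relation symbols (each with an arity), variables and constants, and with formulas built from atoms by $\neg,\land,\lor,\Rightarrow,\equiv,\exists,\forall$. Let $A$ be a formula and let $D$ be a finite non-empty set of constants containing all constants of $A$ (for instance exactly the constants occurring in $A$, if there are any); $D$ is the domain, over which quantifiers range, and each constant denotes itself. A *world* is an assignment of truth values to the set $G$ of all ground atoms $r(\bar c)$ with $r\in\mathcal R$ and $\bar c$ a tuple over $D$. For an assignment $\theta$ of elements of $D$ to the variables put $$P(A,\theta)=\frac{|\{w : w\models A[\theta]\}|}{|\{w\}|}=\frac{|\{w : w\models A[\theta]\}|}{2^{|G|}};$$ for closed $A$ this does not depend on $\theta$ and is the uniform probability $P(A)$ of $A$. For every formula $B$ let $r_B$ be an auxiliary relation symbol whose arguments are the free variables of $B$ (one symbol for all occurrences of the same formula); if $B$ is an atom, $r_B$ stands for $B$ itself. Let $r^{\to}_B, r^{\leftarrow}_B, r^{\sim}_B, r^{\times}_B$ be further auxiliary symbols with the same arguments; all auxiliary symbols are pairwise distinct and do not belong to $\mathcal R$. Every symbol indexed by a formula is applied to the tuple of free variables of that formula, which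 is suppressed below, and $\backslash{+}$ is negation as failure. The rules $\pi^I_A$ are: none if $A$ is an atom; otherwise the rules encoding the immediate subformulas of $A$ together with - $A=\neg B$: $\; r_A \leftarrow \backslash{+}\, r_B$; - $A=C\land D'$: $\; r_A\leftarrow r_C, r_{D'}$; - $A=C\lor D'$: $\; r_A\leftarrow r_C$ and $r_A\leftarrow r_{D'}$; - $A=(C\Rightarrow D')$: $\; r_A\leftarrow \backslash{+}\, r_C$ and $r_A\leftarrow r_{D'}$; - $A=(C\equiv D')$: $\; r^{\to}_A\leftarrow \backslash{+}\, r_C$; $\; r^{\to}_A\leftarrow r_{D'}$; $\; r^{\leftarrow}_A\leftarrow \backslash{+}\, r_{D'}$; $\; r^{\leftarrow}_A\leftarrow r_C$; $\; r_A\leftarrow r^{\to}_A, r^{\leftarrow}_A$; - $A=\exists y\,B$: $\; r_A\leftarrow r_B$; - $A=\forall y\,B$: $\; r^{\sim}_B\leftarrow\backslash{+}\, r_B$; $\; r^{\times}_A\leftarrow r^{\sim}_B$; $\; r_A\leftarrow\backslash{+}\, r^{\times}_A$. The ProbLog program $\Pi^m_A$ consists of the independent probabilistic facts $0.5::a$ for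 all $a\in G$ and of the rules $\pi^I_A$. A stratification of the rules assigns a level to each predicate symbol such that in each rule the positive premises have level at most, and the negated premises level strictly less than, the level of the head. The rules are instantiated with constants from $D$; given the set of probabilistic facts that are true, the standard model is obtained by taking least models stratum by stratum, and the probability of a ground atom under $\Pi^m_A$ is the sum, over all truth assignments to the probabilistic facts in whose standard model the atom is true, of the product of the probabilities ($0.5$ each) of the truth values of the facts. Then $\Pi^m_A$ is stratified and, whichever stratification is used, the probability under $\Pi^m_A$ of $r_A$, with its arguments instantiated by $\theta$, equals $P(A,\theta)$. In particular, for every closed formula $A$ the probability of $r_A$ under $\Pi^m_A$ equals the uniform probability $P(A)$. -/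

import Mathlib

namespace FOProbLog

/-- Terms of a function-free first-order language: variables and constants. -/
inductive Term (V K : Type*) where
  | var (x : V) : Term V K
  | const (c : K) : Term V K

/-- Value of a term under an assignment of constants to variables
(every constant denotes itself). -/
def Term.eval {V K : Type*} (θ : V → K) : Term V K → K
  | .var x => θ x
  | .const c => c

/-- The variable of a term, if it is one. -/
def Term.var? {V K : Type*} : Term V K → Option V
  | .var x => some x
  | .const _ => none

/-- First-order formulas over relation symbols `R` (with arities `ar`), variables `V` and
constants `K`. -/
inductive Formula {R : Type*} (ar : R → ℕ) (V K : Type*) where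
  | atom (r : R) (t : Fin (ar r) → Term V K) : Formula ar V K
  | neg (B : Formula ar V K) : Formula ar V K
  | and (C D : Formula ar V K) : Formula ar V K
  | or (C D : Formula ar V K) : Formula ar V K
  | imp (C D : Formula ar V K) : Formula ar V K
  | iff (C D : Formula ar V K) : Formula ar V K
  | ex (y : V) (B : Formula ar V K) : Formula ar V K
  | all (y : V) (B : Formula ar V K) : Formula ar V K

section Formulas

variable {R : Type*} {ar : R → ℕ} {V K : Type*}

/-- The constants occurring in a formula. -/
def Formula.constants : Formula ar V K → Set K
  | .atom _ t => {c | ∃ i, t i = .const c}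
  | .neg B => B.constants
  | .and C D => C.constants ∪ D.constants
  | .or C D => C.constants ∪ D.constants
  | .imp C D => C.constants ∪ D.constants
  | .iff C D => C.constants ∪ D.constants
  | .ex _ B => B.constants
  | .all _ B => B.constants

/-- The free variables of a formula, listed without repetition. -/
def Formula.freeVars [DecidableEq V] : Formula ar V K → List V
  | .atom _ t => ((List.ofFn t).filterMap Term.var?).dedup
  | .neg B => B.freeVars
  | .and C D => C.freeVars ∪ D.freeVars
  | .or C D => C.freeVars ∪ D.freeVars
  | .imp C D => C.freeVars ∪ D.freeVars
  | .iff C D => C.freeVars ∪ D.freeVars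
  | .ex y B => B.freeVars.filter (fun x => x ≠ y)
  | .all y B => B.freeVars.filter (fun x => x ≠ y)

end Formulas

/-! ### Worlds and the uniform probability of a formula -/

section Semantics

variable {R : Type*} {ar : R → ℕ} {V K : Type*}

/-- A ground atom over a set `P` of predicate symbols with arities `ar`:
a symbol together with a tuple of constants. -/
abbrev GroundAtom {P : Type*} (ar : P → ℕ) (K : Type*) : Type _ :=
  Σ p : P, (Fin (ar p) → K)

/-- All ground atoms with relation symbols in `R` and constants in `D`. -/
def groundAtoms [Fintype R] (ar : R → ℕ) (D : Finset K) : Finset (GroundAtom ar K) :=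
  Finset.univ.sigma fun r => Fintype.piFinset fun _ : Fin (ar r) => D

/-- A truth assignment to the members of a finite set `G` of ground atoms. -/
abbrev Assignment {P : Type*} {ar : P → ℕ} (G : Finset (GroundAtom ar K)) : Type _ :=
  {a : GroundAtom ar K // a ∈ G} → Bool

/-- The set of ground atoms that are true in a truth assignment. -/
def Assignment.trueAtoms {P : Type*} {ar : P → ℕ} {G : Finset (GroundAtom ar K)}
    (w : Assignment G) : Set (GroundAtom ar K) :=
  {a | ∃ h : a ∈ G, w ⟨a, h⟩ = true}

/-- A world over the domain `D`: a truth assignment to all ground atoms. -/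
abbrev World [Fintype R] (ar : R → ℕ) (D : Finset K) : Type _ :=
  Assignment (groundAtoms ar D)

/-- Truth of a formula under an assignment `θ` of its free variables, in the structure with
domain `D` in which exactly the ground atoms in `I` are true. -/
def Formula.Sat [DecidableEq V] (D : Finset K) (I : Set (GroundAtom ar K)) :
    (V → K) → Formula ar V K → Prop
  | θ, .atom r t => (⟨r, fun i => (t i).eval θ⟩ : GroundAtom ar K) ∈ I
  | θ, .neg B => ¬ B.Sat D I θ
  | θ, .and B C => B.Sat D I θ ∧ C.Sat D I θ
  | θ, .or B C => B.Sat D I θ ∨ C.Sat D I θ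
  | θ, .imp B C => B.Sat D I θ → C.Sat D I θ
  | θ, .iff B C => (B.Sat D I θ ↔ C.Sat D I θ)
  | θ, .ex y B => ∃ c ∈ D, B.Sat D I (Function.update θ y c)
  | θ, .all y B => ∀ c ∈ D, B.Sat D I (Function.update θ y c)

open Classical in
/-- The fraction of worlds over the domain `D` in which `A` is true, its free variables (if any)
being interpreted by `θ`. For closed `A` the assignment `θ` plays no role. -/
noncomputable def uniformProb [Fintype R] [DecidableEq V] (D : Finset K)
    (A : Formula ar V K) (θ : V → K) : ℝ :=
  ((Finset.univ.filter fun w : World ar D => A.Sat D w.trueAtoms θ).card : ℝ) /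
    (Fintype.card (World ar D) : ℝ)

end Semantics

/-! ### Stratified logic programs and ProbLog programs -/

/-- Atoms (possibly with variables) over the predicate symbols `P`. -/
structure Atom {P : Type*} (ar : P → ℕ) (V K : Type*) where
  /-- the predicate symbol -/
  pred : P
  /-- the arguments -/
  args : Fin (ar pred) → Term V K

/-- Premises of rules: atoms, or atoms preceded by negation as failure. -/
inductive Literal {P : Type*} (ar : P → ℕ) (V K : Type*) where
  | pos (a : Atom ar V K) : Literal ar V K
  | naf (a : Atom ar V K) : Literal ar V K

/-- A rule `head :- body`. -/
structure Rule {P : Type*} (ar : P → ℕ) (V K : Type*) where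
  /-- the conclusion -/
  head : Atom ar V K
  /-- the premises -/
  body : List (Literal ar V K)

section Programs

variable {P : Type*} {ar : P → ℕ} {V K : Type*}

/-- The ground instance of an atom under a substitution. -/
def Atom.ground (θ : V → K) (a : Atom ar V K) : GroundAtom ar K :=
  ⟨a.pred, fun i => (a.args i).eval θ⟩

/-- Truth of a ground premise: positive premises are evaluated in `J`, negated ones in `N`. -/
def Literal.Holds (N J : Set (GroundAtom ar K)) (θ : V → K) : Literal ar V K → Prop
  | .pos a => a.ground θ ∈ J
  | .naf a => a.ground θ ∉ N

/-- `level` is a stratification of the rules: `level p` is the index of the stratum that contains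
the definition of `p`; positive premises are defined in the stratum of the head or an earlier one,
negated premises in a strictly earlier one. -/
def IsStratification (rules : List (Rule ar V K)) (level : P → ℕ) : Prop :=
  ∀ ρ ∈ rules,
    (∀ a, Literal.pos a ∈ ρ.body → level a.pred ≤ level ρ.head.pred) ∧
    (∀ a, Literal.naf a ∈ ρ.body → level a.pred < level ρ.head.pred)

/-- The least set of ground atoms that includes `I` and is closed under all ground instances,
with constants from `D`, of the rules of stratum `n`; negated premises refer to `I`. -/
def stratumLeastModel (D : Finset K) (rules : List (Rule ar V K)) (level : P → ℕ) (n : ℕ)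
    (I : Set (GroundAtom ar K)) : Set (GroundAtom ar K) :=
  ⋂₀ {J | I ⊆ J ∧ ∀ ρ ∈ rules, level ρ.head.pred = n →
    ∀ θ : V → K, (∀ x, θ x ∈ D) → (∀ l ∈ ρ.body, l.Holds I J θ) → ρ.head.ground θ ∈ J}

/-- The result of evaluating strata `0, …, n - 1` one after the other, from the facts `I`. -/
def evalStrata (D : Finset K) (rules : List (Rule ar V K)) (level : P → ℕ)
    (I : Set (GroundAtom ar K)) : ℕ → Set (GroundAtom ar K)
  | 0 => I
  | n + 1 => stratumLeastModel D rules level n (evalStrata D rules level I n)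

/-- The standard (iterated least) model of a stratified program with facts `I`. -/
def standardModel (D : Finset K) (rules : List (Rule ar V K)) (level : P → ℕ)
    (I : Set (GroundAtom ar K)) : Set (GroundAtom ar K) :=
  ⋃ n, evalStrata D rules level I n

/-- ProbLog programs: finitely many probabilistic facts `weight a :: a` and finitely many rules. -/
structure Program {P : Type*} (ar : P → ℕ) (V K : Type*) where
  /-- the ground atoms declared as probabilistic facts -/
  facts : Finset (GroundAtom ar K)
  /-- the probability attached to a probabilistic fact -/
  weight : GroundAtom ar K → ℝ
  /-- the rules -/
  rules : List (Rule ar V K)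

/-- Probability of a truth assignment to the (independent) probabilistic facts. -/
noncomputable def Program.worldProb (Q : Program ar V K) (w : Assignment Q.facts) : ℝ :=
  ∏ a : {a // a ∈ Q.facts}, if w a = true then Q.weight a else 1 - Q.weight a

open Classical in
/-- Distribution semantics: the probability of a ground atom `q` is the sum of the probabilities of
the truth assignments to the probabilistic facts for which `q` is true in the standard model. -/
noncomputable def Program.prob (Q : Program ar V K) (D : Finset K) (level : P → ℕ)
    (q : GroundAtom ar K) : ℝ :=
  ∑ w ∈ Finset.univ.filter
    (fun w : Assignment Q.facts => q ∈ standardModel D Q.rules level w.trueAtoms), Q.worldProb w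

end Programs

/-! ### The program encoding a formula -/

/-- The kinds of auxiliary relation symbols attached to a formula `B`. -/
inductive AuxKind where
  /-- `r_B` itself -/
  | main
  /-- for `B` of the form `C ≡ D`: the symbol for `C ⇒ D` -/
  | fwd
  /-- for `B` of the form `C ≡ D`: the symbol for `D ⇒ C` -/
  | bwd
  /-- the symbol for the negation of `B`, used when `B` is the scope of a universal quantifier -/
  | compl
  /-- for `B` of the form `∀ y C`: the symbol for `∃ y ¬ C` -/
  | counterex

/-- Predicate symbols of the program: the original relation symbols and fresh, pairwise distinct
auxiliary ones (a single one for all occurrences of the same formula). -/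
inductive Pred {R : Type*} (ar : R → ℕ) (V K : Type*) where
  | base (r : R) : Pred ar V K
  | aux (k : AuxKind) (B : Formula ar V K) : Pred ar V K

section Encoding

variable {R : Type*} {ar : R → ℕ} {V K : Type*} [DecidableEq V]

/-- Arities: an auxiliary symbol attached to `B` has one argument for each free variable of `B`. -/
def predArity (ar : R → ℕ) : Pred ar V K → ℕ
  | .base r => ar r
  | .aux _ B => B.freeVars.length

/-- The auxiliary atom of kind `k` for `B`, applied to the tuple of the free variables of `B`. -/
def auxAtom (k : AuxKind) (B : Formula ar V K) : Atom (predArity (V := V) (K := K) ar) V K :=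
  ⟨.aux k B, fun i => .var (B.freeVars.get i)⟩

/-- The atom `r_A(x̄)`, where `x̄` are the free variables of `A`; it is `A` itself if `A` is atomic. -/
def rAtom : Formula ar V K → Atom (predArity (V := V) (K := K) ar) V K
  | .atom r t => ⟨.base r, t⟩
  | A => auxAtom .main A

/-- The rules encoding a formula. -/
def encode : Formula ar V K → List (Rule (predArity (V := V) (K := K) ar) V K)
  | .atom _ _ => []
  | .neg B =>
      encode B ++ [⟨rAtom (.neg B), [.naf (rAtom B)]⟩]
  | .and C D =>
      encode C ++ encode D ++ [⟨rAtom (.and C D), [.pos (rAtom C), .pos (rAtom D)]⟩]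
  | .or C D =>
      encode C ++ encode D ++
        [⟨rAtom (.or C D), [.pos (rAtom C)]⟩,
         ⟨rAtom (.or C D), [.pos (rAtom D)]⟩]
  | .imp C D =>
      encode C ++ encode D ++
        [⟨rAtom (.imp C D), [.naf (rAtom C)]⟩,
         ⟨rAtom (.imp C D), [.pos (rAtom D)]⟩]
  | .iff C D =>
      encode C ++ encode D ++
        [⟨auxAtom .fwd (.iff C D), [.naf (rAtom C)]⟩,
         ⟨auxAtom .fwd (.iff C D), [.pos (rAtom D)]⟩,
         ⟨auxAtom .bwd (.iff C D), [.naf (rAtom D)]⟩,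
         ⟨auxAtom .bwd (.iff C D), [.pos (rAtom C)]⟩,
         ⟨rAtom (.iff C D), [.pos (auxAtom .fwd (.iff C D)), .pos (auxAtom .bwd (.iff C D))]⟩]
  | .ex y B =>
      encode B ++ [⟨rAtom (.ex y B), [.pos (rAtom B)]⟩]
  | .all y B =>
      encode B ++
        [⟨auxAtom .compl B, [.naf (rAtom B)]⟩,
         ⟨auxAtom .counterex (.all y B), [.pos (auxAtom .compl B)]⟩,
         ⟨rAtom (.all y B), [.naf (auxAtom .counterex (.all y B))]⟩]

/-- Ground atoms of the original language, as ground atoms of the language of the program. -/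
def liftGroundAtom (ar : R → ℕ) :
    GroundAtom ar K ↪ GroundAtom (predArity (V := V) (K := K) ar) K where
  toFun a := ⟨.base a.1, a.2⟩
  inj' := by
    rintro ⟨r, c⟩ ⟨r', c'⟩ h
    cases h
    rfl

/-- The program for `A` over the domain `D`: a fact `0.5 :: a` for every ground atom `a` of the
original language with constants in `D`, together with the rules encoding `A`. -/
noncomputable def formulaProgram [Fintype R] (D : Finset K) (A : Formula ar V K) :
    Program (predArity (V := V) (K := K) ar) V K where
  facts := (groundAtoms ar D).map (liftGroundAtom ar)
  weight := fun _ => 1 / 2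
  rules := encode A

end Encoding

end FOProbLog

namespace FOProbLog

/-! ### The standard model of a stratified program -/

section StandardModel

variable {P : Type*} {ar : P → ℕ} {V K : Type*} {D : Finset K} {rules : List (Rule ar V K)}
  {level : P → ℕ}

/-! For any stratification, the standard model is closed under the rules and supported: an atom
holds in it iff it is a fact or the head of a ground rule whose body holds in the finished model
(`standardModel_closed`, `standardModel_supported`). The levels have then played their part, which
is why the choice of stratification is irrelevant.

Every auxiliary symbol carries its formula, so the rules with a given head symbol are known outright
(`definingRules`). No fact is auxiliary, so an auxiliary atom is equivalent to the disjunction of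
its rule bodies, body variables missing from the head being existentially quantified over `D`
(`auxAtom_mem_standardModel_iff`). These equivalences are the truth conditions of the connectives
and quantifiers, and induction on the formula gives `rAtom_mem_standardModel_iff`: `r_B` holds iff
`B` does, for each truth assignment to the facts.

The probability is then a count: all assignments to the facts have the same weight, and they
correspond bijectively to worlds (`worldEquiv`). -/

theorem Literal.Holds.mono {N J J' : Set (GroundAtom ar K)} {θ : V → K} {l : Literal ar V K}
    (h : l.Holds N J θ) (hJ : J ⊆ J') : l.Holds N J' θ := by
  cases l with
  | pos a => exact hJ h
  | naf a => exact h

theorem holds_pos {N J : Set (GroundAtom ar K)} {θ : V → K} {a : Atom ar V K} :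
    (Literal.pos a).Holds N J θ ↔ a.ground θ ∈ J :=
  Iff.rfl

theorem holds_naf {N J : Set (GroundAtom ar K)} {θ : V → K} {a : Atom ar V K} :
    (Literal.naf a).Holds N J θ ↔ a.ground θ ∉ N :=
  Iff.rfl

theorem subset_stratumLeastModel (n : ℕ) (I : Set (GroundAtom ar K)) :
    I ⊆ stratumLeastModel D rules level n I :=
  Set.subset_sInter fun _ hJ => hJ.1

theorem stratumLeastModel_closed {n : ℕ} {I : Set (GroundAtom ar K)} {ρ : Rule ar V K}
    (hρ : ρ ∈ rules) (hn : level ρ.head.pred = n) {θ : V → K} (hθ : ∀ x, θ x ∈ D)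
    (hb : ∀ l ∈ ρ.body, l.Holds I (stratumLeastModel D rules level n I) θ) :
    ρ.head.ground θ ∈ stratumLeastModel D rules level n I := by
  intro J hJ
  exact hJ.2 ρ hρ hn θ hθ fun l hl => (hb l hl).mono (Set.sInter_subset_of_mem hJ)

/-- Every atom of the least model of a stratum is given or is derived by a rule of the stratum. -/
theorem stratumLeastModel_supported {n : ℕ} {I : Set (GroundAtom ar K)} {a : GroundAtom ar K}
    (ha : a ∈ stratumLeastModel D rules level n I) :
    a ∈ I ∨ ∃ ρ ∈ rules, level ρ.head.pred = n ∧ ∃ θ : V → K, (∀ x, θ x ∈ D) ∧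
      (∀ l ∈ ρ.body, l.Holds I (stratumLeastModel D rules level n I) θ) ∧
      ρ.head.ground θ = a := by
  -- `J` keeps only the supported atoms of the least model. A body true in `J` is true in the least
  -- model, so `J` is itself closed, and leastness puts the whole model inside it.
  let J : Set (GroundAtom ar K) := {a | a ∈ stratumLeastModel D rules level n I ∧
    (a ∈ I ∨ ∃ ρ ∈ rules, level ρ.head.pred = n ∧ ∃ θ : V → K, (∀ x, θ x ∈ D) ∧
      (∀ l ∈ ρ.body, l.Holds I (stratumLeastModel D rules level n I) θ) ∧
      ρ.head.ground θ = a)}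
  have hJ : J ⊆ stratumLeastModel D rules level n I := fun _ h => h.1
  refine (Set.mem_sInter.1 ha J ⟨fun b hb => ⟨subset_stratumLeastModel n I hb, Or.inl hb⟩, ?_⟩).2
  intro ρ hρ hn θ hθ hb
  have hb' : ∀ l ∈ ρ.body, l.Holds I (stratumLeastModel D rules level n I) θ :=
    fun l hl => (hb l hl).mono hJ
  exact ⟨stratumLeastModel_closed hρ hn hθ hb', Or.inr ⟨ρ, hρ, hn, θ, hθ, hb', rfl⟩⟩

theorem evalStrata_mono (I : Set (GroundAtom ar K)) : Monotone (evalStrata D rules level I) :=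
  monotone_nat_of_le_succ fun n => subset_stratumLeastModel n _

theorem evalStrata_subset_standardModel (I : Set (GroundAtom ar K)) (n : ℕ) :
    evalStrata D rules level I n ⊆ standardModel D rules level I :=
  Set.subset_iUnion (evalStrata D rules level I) n

/-- The extension of a predicate does not change once its stratum has been evaluated. -/
theorem mem_evalStrata_of_level_lt {I : Set (GroundAtom ar K)} {a : GroundAtom ar K} {m : ℕ}
    (hm : level a.1 < m) (ha : a ∈ standardModel D rules level I) :
    a ∈ evalStrata D rules level I m := by
  obtain ⟨n, hn⟩ := Set.mem_iUnion.1 ha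
  induction n with
  | zero => exact evalStrata_mono I (Nat.zero_le m) hn
  | succ n ih =>
    rcases le_or_gt (n + 1) m with h | h
    · exact evalStrata_mono I h hn
    · rcases stratumLeastModel_supported hn with h' | ⟨ρ, -, hl, θ, -, -, rfl⟩
      · exact ih h'
      -- An atom first derived at stage `n + 1 > m` would have level `n ≥ m`.
      · have : level ρ.head.pred < m := hm
        omega

/-- Positive premises have level at most that of the head, so they are present once the head's
stratum is complete; a negated premise false in the final model was false at every earlier stage. -/
theorem standardModel_closed (hs : IsStratification rules level) {I : Set (GroundAtom ar K)}
    {ρ : Rule ar V K} (hρ : ρ ∈ rules) {θ : V → K} (hθ : ∀ x, θ x ∈ D)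
    (hb : ∀ l ∈ ρ.body,
      l.Holds (standardModel D rules level I) (standardModel D rules level I) θ) :
    ρ.head.ground θ ∈ standardModel D rules level I := by
  refine evalStrata_subset_standardModel I (level ρ.head.pred + 1) ?_
  refine stratumLeastModel_closed hρ rfl hθ fun l hl => ?_
  have hl' := hb l hl
  cases l with
  | pos a => exact mem_evalStrata_of_level_lt (Nat.lt_succ_of_le ((hs ρ hρ).1 a hl)) hl'
  | naf a => exact fun h => hl' (evalStrata_subset_standardModel I _ h)

/-- Every atom of the standard model is a fact or is derived by a rule from the model. -/
theorem standardModel_supported (hs : IsStratification rules level) {I : Set (GroundAtom ar K)}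
    {a : GroundAtom ar K} (ha : a ∈ standardModel D rules level I) :
    a ∈ I ∨ ∃ ρ ∈ rules, ∃ θ : V → K, (∀ x, θ x ∈ D) ∧
      (∀ l ∈ ρ.body,
        l.Holds (standardModel D rules level I) (standardModel D rules level I) θ) ∧
      ρ.head.ground θ = a := by
  obtain ⟨n, hn⟩ := Set.mem_iUnion.1 ha
  induction n with
  | zero => exact Or.inl hn
  | succ n ih =>
    rcases stratumLeastModel_supported hn with h' | ⟨ρ, hρ, hl, θ, hθ, hb, rfl⟩
    · exact ih h'
    · refine Or.inr ⟨ρ, hρ, θ, hθ, fun l hlb => ?_, rfl⟩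
      have hl' := hb l hlb
      cases l with
      | pos a => exact evalStrata_subset_standardModel I (n + 1) hl'
      -- Strictness matters here: the negated premise was tested before stratum `n`, when its
      -- predicate was already final.
      | naf a =>
        exact fun h => hl' (mem_evalStrata_of_level_lt (hl ▸ (hs ρ hρ).2 a hlb) h)

end StandardModel

/-! ### Levels of predicate symbols -/

section Levels

variable {R : Type*} {ar : R → ℕ} {V K : Type*}

/-- The number of logical symbols of a formula. -/
def Formula.complexity : Formula ar V K → ℕ
  | .atom _ _ => 0
  | .neg B => B.complexity + 1
  | .and C D => C.complexity + D.complexity + 1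
  | .or C D => C.complexity + D.complexity + 1
  | .imp C D => C.complexity + D.complexity + 1
  | .iff C D => C.complexity + D.complexity + 1
  | .ex _ B => B.complexity + 1
  | .all _ B => B.complexity + 1

/-- The height of an auxiliary symbol above the level that belongs to its formula. -/
def AuxKind.offset : AuxKind → ℕ
  | .compl => 3
  | .counterex => 1
  | _ => 2

/-- A stratification of the encoding of every formula. -/
def encodingLevel : Pred ar V K → ℕ
  | .base _ => 0
  | .aux k B => 3 * B.complexity + k.offset

theorem encodingLevel_aux (k : AuxKind) (B : Formula ar V K) :
    encodingLevel (.aux k B) = 3 * B.complexity + k.offset :=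
  rfl

end Levels

/-! ### The rules of the encoding -/

section Encoding

variable {R : Type*} {ar : R → ℕ} {V K : Type*} [DecidableEq V]

/-- Needed because an auxiliary atom records an assignment only on the free variables of its
formula. -/
theorem Formula.sat_congr (D : Finset K) (I : Set (GroundAtom ar K)) (A : Formula ar V K) :
    ∀ {θ θ' : V → K}, (∀ x ∈ A.freeVars, θ x = θ' x) → (A.Sat D I θ ↔ A.Sat D I θ') := by
  induction A with
  | atom r t =>
    intro θ θ' h
    have : (fun i => (t i).eval θ) = fun i => (t i).eval θ' := by
      funext i
      cases hi : t i with
      | const c => rfl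
      | var x =>
        refine h x ?_
        simp only [Formula.freeVars, List.mem_dedup, List.mem_filterMap, List.mem_ofFn]
        exact ⟨t i, ⟨i, rfl⟩, by rw [hi]; rfl⟩
    simp only [Formula.Sat, this]
  | neg B ih =>
    intro θ θ' h
    simp only [Formula.Sat, ih h]
  | and B C ihB ihC | or B C ihB ihC | imp B C ihB ihC | iff B C ihB ihC =>
    intro θ θ' h
    simp only [Formula.freeVars, List.mem_union_iff] at h
    simp only [Formula.Sat, ihB fun x hx => h x (Or.inl hx), ihC fun x hx => h x (Or.inr hx)]
  | ex y B ih | all y B ih =>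
    intro θ θ' h
    have key : ∀ c, B.Sat D I (Function.update θ y c) ↔ B.Sat D I (Function.update θ' y c) := by
      refine fun c => ih fun x hx => ?_
      by_cases hxy : x = y
      · subst hxy; simp
      · simpa [hxy] using h x (by simp [Formula.freeVars, hx, hxy])
    simp only [Formula.Sat, key]

/-- The rules that define a predicate symbol in the encoding of a formula. -/
def definingRules : Pred ar V K → List (Rule (predArity (V := V) (K := K) ar) V K)
  | .aux .main (.neg B) => [⟨auxAtom .main (.neg B), [.naf (rAtom B)]⟩]
  | .aux .main (.and C D) => [⟨auxAtom .main (.and C D), [.pos (rAtom C), .pos (rAtom D)]⟩]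
  | .aux .main (.or C D) =>
      [⟨auxAtom .main (.or C D), [.pos (rAtom C)]⟩, ⟨auxAtom .main (.or C D), [.pos (rAtom D)]⟩]
  | .aux .main (.imp C D) =>
      [⟨auxAtom .main (.imp C D), [.naf (rAtom C)]⟩, ⟨auxAtom .main (.imp C D), [.pos (rAtom D)]⟩]
  | .aux .main (.iff C D) =>
      [⟨auxAtom .main (.iff C D),
        [.pos (auxAtom .fwd (.iff C D)), .pos (auxAtom .bwd (.iff C D))]⟩]
  | .aux .main (.ex y B) => [⟨auxAtom .main (.ex y B), [.pos (rAtom B)]⟩]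
  | .aux .main (.all y B) =>
      [⟨auxAtom .main (.all y B), [.naf (auxAtom .counterex (.all y B))]⟩]
  | .aux .fwd (.iff C D) =>
      [⟨auxAtom .fwd (.iff C D), [.naf (rAtom C)]⟩, ⟨auxAtom .fwd (.iff C D), [.pos (rAtom D)]⟩]
  | .aux .bwd (.iff C D) =>
      [⟨auxAtom .bwd (.iff C D), [.naf (rAtom D)]⟩, ⟨auxAtom .bwd (.iff C D), [.pos (rAtom C)]⟩]
  | .aux .compl B => [⟨auxAtom .compl B, [.naf (rAtom B)]⟩]
  | .aux .counterex (.all y B) =>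
      [⟨auxAtom .counterex (.all y B), [.pos (auxAtom .compl B)]⟩]
  | _ => []

/-- The head symbol names the formula its rule comes from, so repeated subformulas contribute only
copies of the same rules. In particular `compl` depends on the scope `B` alone, whichever variable
is quantified. -/
theorem mem_definingRules_of_mem_encode {A : Formula ar V K}
    {ρ : Rule (predArity (V := V) (K := K) ar) V K} (hρ : ρ ∈ encode A) :
    ρ ∈ definingRules ρ.head.pred := by
  induction A with
  | atom r t => simp [encode] at hρ
  | neg B ih | ex y B ih | all y B ih =>
    simp only [encode, List.mem_append, List.mem_cons, List.not_mem_nil, or_false] at hρ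
    rcases hρ with h | hρ
    · exact ih h
    · rcases hρ with rfl | rfl | rfl <;> simp [rAtom, auxAtom, definingRules]
  | and B C ihB ihC | or B C ihB ihC | imp B C ihB ihC | iff B C ihB ihC =>
    simp only [encode, List.mem_append, List.mem_cons, List.not_mem_nil, or_false] at hρ
    rcases hρ with (h | h) | hρ
    · exact ihB h
    · exact ihC h
    · rcases hρ with rfl | rfl | rfl | rfl | rfl <;> simp [rAtom, auxAtom, definingRules]

theorem head_of_mem_definingRules {k : AuxKind} {B : Formula ar V K}
    {ρ : Rule (predArity (V := V) (K := K) ar) V K} (hρ : ρ ∈ definingRules (.aux k B)) :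
    ρ.head = auxAtom k B := by
  cases k <;> cases B <;>
    simp only [definingRules, List.mem_cons, List.not_mem_nil, or_false] at hρ <;>
    first
      | (subst hρ; rfl)
      | (rcases hρ with rfl | rfl <;> rfl)

theorem encodingLevel_rAtom_le (B : Formula ar V K) :
    encodingLevel (rAtom B).pred ≤ 3 * B.complexity + 2 := by
  cases B <;> simp [rAtom, auxAtom, encodingLevel, AuxKind.offset]

theorem rAtom_eq_auxAtom {A : Formula ar V K} (hA : ∀ r t, A ≠ .atom r t) :
    rAtom A = auxAtom .main A := by
  cases A with
  | atom r t => exact absurd rfl (hA r t)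
  | _ => rfl

/-- Three levels per logical symbol suffice. For `∀ y B` with `c` the complexity of `B`, the chain
`r_B`, `compl`, `counterex`, `r_A` has levels at most `3c+2`, then `3c+3`, `3c+4`, `3c+5`, so both
negations go strictly up. -/
theorem isStratification_encode (A : Formula ar V K) :
    IsStratification (encode A) encodingLevel := by
  induction A with
  | atom r t => simp [IsStratification, encode]
  | neg B ih | ex y B ih | all y B ih =>
    intro ρ hρ
    simp only [encode, List.mem_append, List.mem_cons, List.not_mem_nil, or_false] at hρ
    rcases hρ with h | hρ
    · exact ih ρ h
    · have := encodingLevel_rAtom_le B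
      rcases hρ with rfl | rfl | rfl <;>
        simp [rAtom_eq_auxAtom, auxAtom, encodingLevel_aux, Formula.complexity,
          AuxKind.offset] <;> omega
  | and B C ihB ihC | or B C ihB ihC | imp B C ihB ihC | iff B C ihB ihC =>
    intro ρ hρ
    simp only [encode, List.mem_append, List.mem_cons, List.not_mem_nil, or_false] at hρ
    rcases hρ with (h | h) | hρ
    · exact ihB ρ h
    · exact ihC ρ h
    · have := encodingLevel_rAtom_le B
      have := encodingLevel_rAtom_le C
      rcases hρ with rfl | rfl | rfl | rfl | rfl <;>
        simp [rAtom_eq_auxAtom, auxAtom, encodingLevel_aux, Formula.complexity,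
          AuxKind.offset] <;> omega

theorem auxAtom_ground_eq_iff {k : AuxKind} {B : Formula ar V K} {θ θ' : V → K} :
    (auxAtom k B).ground θ' = (auxAtom k B).ground θ ↔ ∀ x ∈ B.freeVars, θ' x = θ x := by
  constructor
  · intro h x hx
    obtain ⟨i, rfl⟩ := List.get_of_mem hx
    exact congrFun (eq_of_heq (Sigma.mk.inj h).2) i
  · intro h
    refine Sigma.ext rfl (heq_of_eq (funext fun i => ?_))
    exact h _ (List.get_mem _ _)

end Encoding

/-! ### Correctness of the encoding -/

section Correctness

variable {R : Type*} {ar : R → ℕ} {V K : Type*} [DecidableEq V] {D : Finset K}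
  {rules : List (Rule (predArity (V := V) (K := K) ar) V K)} {level : Pred ar V K → ℕ}
  {F : Set (GroundAtom (predArity (V := V) (K := K) ar) K)}

/-- An auxiliary atom is true in the standard model iff the body of one of its defining rules is. -/
theorem auxAtom_mem_standardModel_iff (hs : IsStratification rules level)
    (hdef : ∀ ρ ∈ rules, ρ ∈ definingRules ρ.head.pred)
    (hF : F ⊆ Set.range (liftGroundAtom ar)) {k : AuxKind} {B : Formula ar V K}
    (hB : definingRules (.aux k B) ⊆ rules) {θ : V → K} :
    (auxAtom k B).ground θ ∈ standardModel D rules level F ↔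
      ∃ ρ ∈ definingRules (.aux k B), ∃ θ' : V → K, (∀ x, θ' x ∈ D) ∧
        (∀ x ∈ B.freeVars, θ' x = θ x) ∧
        ∀ l ∈ ρ.body,
          l.Holds (standardModel D rules level F) (standardModel D rules level F) θ' := by
  constructor
  · intro h
    rcases standardModel_supported hs h with h | ⟨ρ, hρ, θ', hθ', hb, he⟩
    -- Facts carry `base` symbols, so an auxiliary atom cannot be one.
    · obtain ⟨a, ha⟩ := hF h
      have : Pred.base a.1 = Pred.aux k B := congrArg Sigma.fst ha
      cases this
    · have hp : ρ.head.pred = .aux k B := congrArg Sigma.fst he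
      have hρ' : ρ ∈ definingRules (.aux k B) := hp ▸ hdef ρ hρ
      rw [head_of_mem_definingRules hρ', auxAtom_ground_eq_iff] at he
      exact ⟨ρ, hρ', θ', hθ', he, hb⟩
  · rintro ⟨ρ, hρ, θ', hθ', he, hb⟩
    have := standardModel_closed hs (hB hρ) hθ' hb
    rwa [head_of_mem_definingRules hρ, auxAtom_ground_eq_iff.2 he] at this

/-- The same as `auxAtom_mem_standardModel_iff` for rules whose bodies have a truth value that
depends on the arguments of the head only. -/
theorem auxAtom_mem_standardModel_iff_of_congr (hs : IsStratification rules level)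
    (hdef : ∀ ρ ∈ rules, ρ ∈ definingRules ρ.head.pred)
    (hF : F ⊆ Set.range (liftGroundAtom ar)) {k : AuxKind} {B : Formula ar V K}
    (hB : definingRules (.aux k B) ⊆ rules) {p : (V → K) → Prop}
    (hp : ∀ θ : V → K, (∀ x, θ x ∈ D) → ((∃ ρ ∈ definingRules (.aux k B), ∀ l ∈ ρ.body,
      l.Holds (standardModel D rules level F) (standardModel D rules level F) θ) ↔ p θ))
    (hc : ∀ θ θ' : V → K, (∀ x ∈ B.freeVars, θ' x = θ x) → (p θ' ↔ p θ))
    {θ : V → K} (hθ : ∀ x, θ x ∈ D) :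
    (auxAtom k B).ground θ ∈ standardModel D rules level F ↔ p θ := by
  rw [auxAtom_mem_standardModel_iff hs hdef hF hB]
  constructor
  · rintro ⟨ρ, hρ, θ', hθ', he, hb⟩
    exact (hc θ θ' he).1 ((hp θ' hθ').1 ⟨ρ, hρ, hb⟩)
  · intro h
    obtain ⟨ρ, hρ, hb⟩ := (hp θ hθ).2 h
    exact ⟨ρ, hρ, θ, hθ, fun _ _ => rfl, hb⟩

/-- No rule has a `base` symbol in its head, so the rules leave the facts unchanged. -/
theorem liftGroundAtom_mem_standardModel_iff (hs : IsStratification rules level)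
    (hdef : ∀ ρ ∈ rules, ρ ∈ definingRules ρ.head.pred) (a : GroundAtom ar K) :
    liftGroundAtom ar a ∈ standardModel D rules level F ↔ liftGroundAtom ar a ∈ F := by
  refine ⟨fun h => ?_, fun h => evalStrata_subset_standardModel F 0 h⟩
  rcases standardModel_supported hs h with h | ⟨ρ, hρ, θ', -, -, he⟩
  · exact h
  · have hp : ρ.head.pred = .base a.1 := congrArg Sigma.fst he
    have := hdef ρ hρ
    rw [hp] at this
    simp [definingRules] at this

/-- In the standard model of a program that contains the rules encoding `B`, the atom `r_B` is
true iff `B` is. -/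
theorem rAtom_mem_standardModel_iff (hs : IsStratification rules level)
    (hdef : ∀ ρ ∈ rules, ρ ∈ definingRules ρ.head.pred)
    (hF : F ⊆ Set.range (liftGroundAtom ar)) (B : Formula ar V K) (hB : encode B ⊆ rules)
    {θ : V → K} (hθ : ∀ x, θ x ∈ D) :
    (rAtom B).ground θ ∈ standardModel D rules level F ↔
      B.Sat D (liftGroundAtom ar ⁻¹' F) θ := by
  -- The program stays fixed while `B` shrinks; only `encode B ⊆ rules` is inherited. The assignment
  -- must vary because of the quantifiers.
  induction B generalizing θ with
  | atom r t =>
    exact liftGroundAtom_mem_standardModel_iff hs hdef ⟨r, fun i => (t i).eval θ⟩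
  | neg B ih =>
    simp only [encode, List.append_subset] at hB
    refine auxAtom_mem_standardModel_iff_of_congr hs hdef hF (k := .main) (B := (.neg B)) hB.2
      (p := fun θ => (Formula.neg B).Sat D (liftGroundAtom ar ⁻¹' F) θ) (fun θ hθ => ?_)
      (fun _ _ h => Formula.sat_congr D _ _ h) hθ
    simp [definingRules, holds_naf, Formula.Sat, ih hB.1 hθ]
  | and B C ihB ihC =>
    simp only [encode, List.append_subset] at hB
    refine auxAtom_mem_standardModel_iff_of_congr hs hdef hF (k := .main) (B := .and B C) hB.2
      (p := fun θ => Formula.Sat D (liftGroundAtom ar ⁻¹' F) θ _) (fun θ hθ => ?_)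
      (fun _ _ h => Formula.sat_congr D _ _ h) hθ
    simp [definingRules, holds_pos, Formula.Sat, ihB hB.1.1 hθ, ihC hB.1.2 hθ]
  | or B C ihB ihC =>
    simp only [encode, List.append_subset] at hB
    refine auxAtom_mem_standardModel_iff_of_congr hs hdef hF (k := .main) (B := .or B C) hB.2
      (p := fun θ => Formula.Sat D (liftGroundAtom ar ⁻¹' F) θ _) (fun θ hθ => ?_)
      (fun _ _ h => Formula.sat_congr D _ _ h) hθ
    simp [definingRules, holds_pos, Formula.Sat, ihB hB.1.1 hθ, ihC hB.1.2 hθ]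
  | imp B C ihB ihC =>
    simp only [encode, List.append_subset] at hB
    refine auxAtom_mem_standardModel_iff_of_congr hs hdef hF (k := .main) (B := (.imp B C)) hB.2
      (p := fun θ => Formula.Sat D (liftGroundAtom ar ⁻¹' F) θ _) (fun θ hθ => ?_)
      (fun _ _ h => Formula.sat_congr D _ _ h) hθ
    simp [definingRules, holds_pos, holds_naf, Formula.Sat, ihB hB.1.1 hθ, ihC hB.1.2 hθ]
    exact imp_iff_not_or.symm
  | iff B C ihB ihC =>
    simp only [encode, List.append_subset] at hB
    obtain ⟨⟨hB₁, hB₂⟩, hB₃⟩ := hB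
    have hf : ∀ θ : V → K, (∀ x, θ x ∈ D) →
        ((auxAtom .fwd (B.iff C)).ground θ ∈ standardModel D rules level F ↔
          (B.imp C).Sat D (liftGroundAtom ar ⁻¹' F) θ) := by
      intro θ hθ
      refine auxAtom_mem_standardModel_iff_of_congr hs hdef hF (k := .fwd) (B := .iff B C)
        (fun ρ hρ => hB₃ (by simp [definingRules] at hρ; rcases hρ with rfl | rfl <;> simp))
        (p := fun θ => Formula.Sat D (liftGroundAtom ar ⁻¹' F) θ _) (fun θ hθ => ?_)
        (fun _ _ h => Formula.sat_congr D _ (B.imp C) h) hθ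
      simp [definingRules, holds_pos, holds_naf, Formula.Sat, ihB hB₁ hθ, ihC hB₂ hθ]
      exact imp_iff_not_or.symm
    have hb : ∀ θ : V → K, (∀ x, θ x ∈ D) →
        ((auxAtom .bwd (B.iff C)).ground θ ∈ standardModel D rules level F ↔
          (C.Sat D (liftGroundAtom ar ⁻¹' F) θ → B.Sat D (liftGroundAtom ar ⁻¹' F) θ)) := by
      intro θ hθ
      refine auxAtom_mem_standardModel_iff_of_congr hs hdef hF (k := .bwd) (B := .iff B C)
        (fun ρ hρ => hB₃ (by simp [definingRules] at hρ; rcases hρ with rfl | rfl <;> simp))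
        -- Spelled out rather than taken from `C.imp B`, whose free-variable list is the union in
        -- the other order.
        (p := fun θ => C.Sat D (liftGroundAtom ar ⁻¹' F) θ → B.Sat D (liftGroundAtom ar ⁻¹' F) θ)
        (fun θ hθ => ?_) (fun θ θ' h => ?_) hθ
      · simp [definingRules, holds_pos, holds_naf, ihB hB₁ hθ, ihC hB₂ hθ]
        exact imp_iff_not_or.symm
      · simp only [Formula.freeVars, List.mem_union_iff] at h
        rw [Formula.sat_congr D _ B fun x hx => h x (Or.inl hx),
          Formula.sat_congr D _ C fun x hx => h x (Or.inr hx)]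
    refine auxAtom_mem_standardModel_iff_of_congr hs hdef hF (k := .main) (B := .iff B C)
      (fun ρ hρ => hB₃ (by simp [definingRules] at hρ; simp [hρ, rAtom]))
      (p := fun θ => Formula.Sat D (liftGroundAtom ar ⁻¹' F) θ _) (fun θ hθ => ?_)
      (fun _ _ h => Formula.sat_congr D _ _ h) hθ
    simp [definingRules, holds_pos, hf θ hθ, hb θ hθ, Formula.Sat, iff_iff_implies_and_implies]
  | ex y B ih =>
    simp only [encode, List.append_subset] at hB
    -- Here `y` may occur in the body but not in the head, so the rule instance is free to choose
    -- it: its value `θ' y` is the witness, and conversely a witness `c` gives the instance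
    -- `Function.update θ y c`.
    refine (auxAtom_mem_standardModel_iff hs hdef hF (k := .main) (B := (.ex y B)) hB.2).trans ?_
    simp only [definingRules, List.mem_singleton, exists_eq_left, forall_eq, holds_pos,
      Formula.Sat]
    constructor
    · rintro ⟨θ', hθ', he, hb⟩
      refine ⟨θ' y, hθ' y, (Formula.sat_congr D _ B fun x hx => ?_).1 ((ih hB.1 hθ').1 hb)⟩
      by_cases hxy : x = y
      · subst hxy; simp
      · simpa [hxy] using he x (by simp [Formula.freeVars, hx, hxy])
    · rintro ⟨c, hc, h⟩
      have hθ' : ∀ x, Function.update θ y c x ∈ D := by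
        intro x
        by_cases hxy : x = y
        · subst hxy; simpa using hc
        · simpa [hxy] using hθ x
      refine ⟨Function.update θ y c, hθ', fun x hx => ?_, (ih hB.1 hθ').2 h⟩
      have : x ≠ y := by simpa using (List.mem_filter.1 hx).2
      simp [this]
  | all y B ih =>
    simp only [encode, List.append_subset] at hB
    obtain ⟨hB₁, hB₂⟩ := hB
    have hcompl : ∀ θ : V → K, (∀ x, θ x ∈ D) →
        ((auxAtom .compl B).ground θ ∈ standardModel D rules level F ↔
          ¬ B.Sat D (liftGroundAtom ar ⁻¹' F) θ) := by
      intro θ hθ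
      refine auxAtom_mem_standardModel_iff_of_congr hs hdef hF (k := .compl) (B := B)
        (fun ρ hρ => hB₂ (by simp [definingRules] at hρ; simp [hρ]))
        (p := fun θ => ¬ B.Sat D (liftGroundAtom ar ⁻¹' F) θ) (fun θ hθ => ?_)
        (fun _ _ h => not_congr (Formula.sat_congr D _ _ h)) hθ
      simp [definingRules, holds_naf, ih hB₁ hθ]
    -- A counterexample is found as in the existential case, with `compl` in place of `r_B`;
    -- negating `counterex` then yields the universal quantifier.
    have hcounter : ∀ θ : V → K, (∀ x, θ x ∈ D) →
        ((auxAtom .counterex (.all y B)).ground θ ∈ standardModel D rules level F ↔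
          ¬ (Formula.all y B).Sat D (liftGroundAtom ar ⁻¹' F) θ) := by
      intro θ hθ
      refine (auxAtom_mem_standardModel_iff hs hdef hF (k := .counterex) (B := .all y B)
        (fun ρ hρ => hB₂ (by simp [definingRules] at hρ; simp [hρ]))).trans ?_
      simp only [definingRules, List.mem_singleton, exists_eq_left, forall_eq, holds_pos,
        Formula.Sat, not_forall, exists_prop]
      constructor
      · rintro ⟨θ', hθ', he, hb⟩
        refine ⟨θ' y, hθ' y,
          (not_congr (Formula.sat_congr D _ B fun x hx => ?_)).1 ((hcompl θ' hθ').1 hb)⟩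
        by_cases hxy : x = y
        · subst hxy; simp
        · simpa [hxy] using he x (by simp [Formula.freeVars, hx, hxy])
      · rintro ⟨c, hc, h⟩
        have hθ' : ∀ x, Function.update θ y c x ∈ D := by
          intro x
          by_cases hxy : x = y
          · subst hxy; simpa using hc
          · simpa [hxy] using hθ x
        refine ⟨Function.update θ y c, hθ', fun x hx => ?_, (hcompl _ hθ').2 h⟩
        have : x ≠ y := by simpa using (List.mem_filter.1 hx).2
        simp [this]
    refine auxAtom_mem_standardModel_iff_of_congr hs hdef hF (k := .main) (B := .all y B)
      (fun ρ hρ => hB₂ (by simp [definingRules] at hρ; simp [hρ, rAtom]))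
      (p := fun θ => Formula.Sat D (liftGroundAtom ar ⁻¹' F) θ _) (fun θ hθ => ?_)
      (fun _ _ h => Formula.sat_congr D _ _ h) hθ
    simp [definingRules, holds_naf, hcounter θ hθ]

end Correctness

/-! ### Probabilities -/

section Probability

variable {R : Type*} {ar : R → ℕ} {V K : Type*} [Fintype R] [DecidableEq V]

/-- The ground atoms of the original language correspond to the probabilistic facts. -/
noncomputable def factEquiv (D : Finset K) (A : Formula ar V K) :
    {a // a ∈ groundAtoms ar D} ≃ {a // a ∈ (formulaProgram D A).facts} :=
  Equiv.ofBijective (fun a => ⟨liftGroundAtom ar a, Finset.mem_map_of_mem _ a.2⟩)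
    ⟨fun _ _ h => Subtype.ext ((liftGroundAtom ar).injective (congrArg Subtype.val h)), fun a => by
      obtain ⟨b, hb, h⟩ := Finset.mem_map.1 a.2
      exact ⟨⟨b, hb⟩, Subtype.ext h⟩⟩

/-- Worlds are the same as truth assignments to the probabilistic facts of the program. -/
noncomputable def worldEquiv (D : Finset K) (A : Formula ar V K) :
    Assignment (formulaProgram D A).facts ≃ World ar D :=
  Equiv.arrowCongr (factEquiv D A).symm (Equiv.refl Bool)

/-- Identifies the world with the interpretation in which `rAtom_mem_standardModel_iff` evaluates
the formula. -/
theorem trueAtoms_worldEquiv (D : Finset K) (A : Formula ar V K)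
    (w : Assignment (formulaProgram D A).facts) :
    (worldEquiv D A w).trueAtoms = liftGroundAtom ar ⁻¹' w.trueAtoms := by
  ext a
  constructor
  · rintro ⟨h, hw⟩
    exact ⟨Finset.mem_map_of_mem _ h, hw⟩
  · rintro ⟨h, hw⟩
    exact ⟨(Finset.mem_map' _).1 h, hw⟩

theorem trueAtoms_subset_range (D : Finset K) (A : Formula ar V K)
    (w : Assignment (formulaProgram D A).facts) :
    w.trueAtoms ⊆ Set.range (liftGroundAtom ar) := by
  rintro a ⟨h, -⟩
  obtain ⟨b, -, rfl⟩ := Finset.mem_map.1 h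
  exact ⟨b, rfl⟩

/-- Since `1 - 1/2 = 1/2`, true and false facts contribute the same factor. -/
theorem worldProb_formulaProgram (D : Finset K) (A : Formula ar V K)
    (w : Assignment (formulaProgram D A).facts) :
    (formulaProgram D A).worldProb w = (1 / 2) ^ (groundAtoms ar D).card := by
  have h : ∀ a : {a // a ∈ (formulaProgram D A).facts},
      (if w a = true then (formulaProgram D A).weight a else 1 - (formulaProgram D A).weight a)
        = 1 / 2 := by
    intro a
    simp only [formulaProgram]
    split_ifs <;> norm_num
  rw [Program.worldProb, Finset.prod_congr rfl fun a _ => h a, Finset.prod_const, Finset.card_univ,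
    Fintype.card_coe]
  simp [formulaProgram]

end Probability

end FOProbLog


/-- `D` is the finite non-empty domain; it contains the constants of `A` (in particular it may be
the set of the constants of `A`). The program for `A` is stratified, and for whichever
stratification it is evaluated, the probability of `r_A` is the uniform probability of `A`.
The assignment `θ` interprets the free variables of `A`; for closed `A` both sides do not depend
on it. -/
theorem mainTheorem2 {R V K : Type*} [Fintype R] [DecidableEq V] (ar : R → ℕ)
    (A : FOProbLog.Formula ar V K) (D : Finset K) (hD : D.Nonempty)
    (hAD : A.constants ⊆ (D : Set K)) :
    (∃ level, FOProbLog.IsStratification (FOProbLog.formulaProgram D A).rules level) ∧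
    ∀ level, FOProbLog.IsStratification (FOProbLog.formulaProgram D A).rules level →
      ∀ θ : V → K, (∀ x, θ x ∈ D) →
        (FOProbLog.formulaProgram D A).prob D level ((FOProbLog.rAtom A).ground θ) =
          FOProbLog.uniformProb D A θ := by

  classical
  refine ⟨⟨FOProbLog.encodingLevel, FOProbLog.isStratification_encode A⟩, ?_⟩
  intro level hs θ hθ
  rw [FOProbLog.Program.prob, FOProbLog.uniformProb,
    Finset.sum_congr rfl fun w _ => FOProbLog.worldProb_formulaProgram D A w,
    Finset.sum_const, nsmul_eq_mul]
  have hcard : Fintype.card (FOProbLog.World ar D) =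
      2 ^ (FOProbLog.groundAtoms ar D).card := by simp
  -- Correctness, applied world by world, makes the bijection carry the assignments deriving `r_A`
  -- onto the worlds satisfying `A`.
  have hfilter := Finset.card_equiv (FOProbLog.worldEquiv D A)
    (s := Finset.univ.filter fun w : FOProbLog.Assignment (FOProbLog.formulaProgram D A).facts =>
      (FOProbLog.rAtom A).ground θ ∈
        FOProbLog.standardModel D (FOProbLog.formulaProgram D A).rules level w.trueAtoms)
    (t := Finset.univ.filter fun w : FOProbLog.World ar D => A.Sat D w.trueAtoms θ)
    (fun w => by
      simp only [Finset.mem_filter, Finset.mem_univ, true_and]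
      rw [FOProbLog.trueAtoms_worldEquiv]
      exact FOProbLog.rAtom_mem_standardModel_iff hs
        (fun _ h => FOProbLog.mem_definingRules_of_mem_encode h)
        (FOProbLog.trueAtoms_subset_range D A w) A (List.Subset.refl _) hθ)
  rw [hcard, one_div, inv_pow, div_eq_mul_inv]
  push_cast
  congr 2
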